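/- Let $s=(s_n)_{n\ge 0}$, normalized by $s_0=1$, be the moment sequence $s_n=\int x^n\,d\mu(x)$ of a positive measure $\mu$ on $\mathbb R$ with infinite support and moments of every order, and assume that the Hamburger moment problem for $s$ is indeterminate, i.e. has more than one solution $\mu$. Let $(p_n)_{n\ge 0}$ be the associated orthonormal polynomials ($\deg p_n=n$, positive leading coefficient) and $q_n(z)=\int \frac{p_n(z)-p_n(x)}{z-x}\,d\mu(x)$ the polynomials of the second kind. For $z\in\mathbb C$ put $\mathfrak p_z=(p_n(z))_{n\ge0}$, $\mathfrak q_z=(q_n(z))_{n\ge0}$ (both belong to $\ell^2$), and for $u,v\in\mathbb C$ let $$A(u,v)=(u-v)\sum_{k=0}^\infty q_k(u)q_k(v),\qquad B(u,v)=-1+(u-v)\sum_{k=0}^\infty p_k(u)q_k(v),$$ $$C(u,v)=1+(u-v)\sum_{k=0}^\infty q_k(u)p_k(v),\qquad D(u,v)=(u-v)\sum_{k=0}^\infty p_k(u)p_k(v).$$ Let $J$ be the Jacobi matrix, i.e. the symmetric tridiagonal matrix with diagonal entries $b_n=\int x\,p_n(x)^2\,d\mu(x)$ and off-diagonal entries $a_n=\int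 x\,p_n(x)p_{n+1}(x)\,d\mu(x)$, and let the Jacobi operator $(T,D(T))$ be the closure in $\ell^2$ of $J$ acting on the complex sequences with only finitely many non-zero terms. For a function $F$ on $\mathbb C^2$ write $Z(F)_v=\{u\in\mathbb C: F(u,v)=0\}$. Let $v\in\mathbb R$. (i) If $u\in Z(D)_v$ is real with $u<v$ and $]u,v[\,\cap Z(D)_v=\emptyset$, then $B(u,v)$ is real, $B(u,v)>0$, and $\mathfrak p_u+B(u,v)\,\mathfrak p_v\in D(T)$. (ii) If $u\in Z(A)_v$ is real with $u<v$ and $]u,v[\,\cap Z(A)_v=\emptyset$, then $C(u,v)$ is real, $C(u,v)<0$, and $\mathfrak q_u-C(u,v)\,\mathfrak q_v\in D(T)$. -/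

import Mathlib

open MeasureTheory Polynomial

noncomputable section

namespace HamburgerMoment

/-- `μ` is a solution of the Hamburger moment problem for `s`: it has moments of every order, and
its `n`-th moment is `s n`. -/
def IsSolution (s : ℕ → ℝ) (μ : Measure ℝ) : Prop :=
  ∀ n : ℕ, Integrable (fun x : ℝ => x ^ n) μ ∧ ∫ x, x ^ n ∂μ = s n

/-- `s` is the moment sequence of a positive measure with infinite support. -/
def IsMomentSequence (s : ℕ → ℝ) : Prop :=
  ∃ μ : Measure ℝ, IsSolution s μ ∧ μ.support.Infinite

/-- The moment problem for `s` is indeterminate: there are several solutions. -/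
def IsIndeterminate (s : ℕ → ℝ) : Prop :=
  ∃ μ ν : Measure ℝ, IsSolution s μ ∧ IsSolution s ν ∧ μ ≠ ν

/-- The moment functional `P ↦ ∫ P dμ`, for any solution `μ`. -/
def momentFunctional (s : ℕ → ℝ) (P : ℝ[X]) : ℝ :=
  P.sum fun k c => c * s k

/-- The monic orthogonal polynomials (Gram–Schmidt applied to `1, X, X², …`). -/
def monicOP (s : ℕ → ℝ) (n : ℕ) : ℝ[X] :=
  X ^ n - ∑ k : Fin n,
    C (momentFunctional s (X ^ n * monicOP s k) / momentFunctional s (monicOP s k ^ 2)) *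
      monicOP s k
termination_by n
decreasing_by all_goals exact k.isLt

/-- The orthonormal polynomials `p n`, of degree `n` and with positive leading coefficient. -/
def orthoPoly (s : ℕ → ℝ) (n : ℕ) : ℝ[X] :=
  C (Real.sqrt (momentFunctional s (monicOP s n ^ 2)))⁻¹ * monicOP s n

/-- The value `p_n(z)`. -/
def p (s : ℕ → ℝ) (n : ℕ) (z : ℂ) : ℂ := aeval z (orthoPoly s n)

/-- The value `q_n(z) = ∫ (p_n(z) - p_n(x)) / (z - x) dμ(x)` of the polynomial of the second kind,
computed from `(z ^ k - x ^ k) / (z - x) = ∑ j < k, z ^ j x ^ (k - 1 - j)`. -/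
def q (s : ℕ → ℝ) (n : ℕ) (z : ℂ) : ℂ :=
  (orthoPoly s n).sum fun k c => (c : ℂ) * ∑ j ∈ Finset.range k, z ^ j * (s (k - 1 - j) : ℂ)

/-- The Nevanlinna function `A`. -/
def nevA (s : ℕ → ℝ) (u v : ℂ) : ℂ := (u - v) * ∑' k, q s k u * q s k v

/-- The Nevanlinna function `B`. -/
def nevB (s : ℕ → ℝ) (u v : ℂ) : ℂ := -1 + (u - v) * ∑' k, p s k u * q s k v

/-- The Nevanlinna function `C`. -/
def nevC (s : ℕ → ℝ) (u v : ℂ) : ℂ := 1 + (u - v) * ∑' k, q s k u * p s k v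

/-- The Nevanlinna function `D`. -/
def nevD (s : ℕ → ℝ) (u v : ℂ) : ℂ := (u - v) * ∑' k, p s k u * p s k v

/-- The zero set `Z(F)_v` of `F(·, v)`. -/
def zeroSet (F : ℂ → ℂ → ℂ) (v : ℂ) : Set ℂ := {u | F u v = 0}

/-- The off-diagonal recurrence coefficients `a n = ∫ x p_n p_{n+1} dμ`. -/
def coeffA (s : ℕ → ℝ) (n : ℕ) : ℝ :=
  momentFunctional s (X * orthoPoly s n * orthoPoly s (n + 1))

/-- The diagonal recurrence coefficients `b n = ∫ x p_n ^ 2 dμ`. -/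
def coeffB (s : ℕ → ℝ) (n : ℕ) : ℝ :=
  momentFunctional s (X * orthoPoly s n ^ 2)

/-- The Jacobi matrix times a column: `(J c) n = a (n-1) c (n-1) + b n c n + a n c (n+1)`,
with `a (-1) = 0`. -/
def jacobiMul (s : ℕ → ℝ) (c : ℕ → ℂ) (n : ℕ) : ℂ :=
  (if n = 0 then 0 else (coeffA s (n - 1) : ℂ) * c (n - 1)) + (coeffB s n : ℂ) * c n +
    (coeffA s n : ℂ) * c (n + 1)

/-- The Hilbert space `ℓ²` of square summable complex sequences. -/
abbrev L2 : Type := lp (fun _ : ℕ => ℂ) 2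

/-- The subspace of sequences with only finitely many non-zero terms. -/
def finiteSeq : Submodule ℂ L2 where
  carrier := {c | (Function.support (c : ℕ → ℂ)).Finite}
  zero_mem' := by
    change (Function.support (0 : ℕ → ℂ)).Finite
    simp
  add_mem' := by
    intro x y hx hy
    refine (Set.Finite.union hx hy).subset ?_
    rw [lp.coeFn_add]
    exact Function.support_add _ _
  smul_mem' := by
    intro r x hx
    refine Set.Finite.subset hx ?_
    rw [lp.coeFn_smul]
    exact Function.support_const_smul_subset _ _

theorem finite_support_jacobiMul (s : ℕ → ℝ) {c : ℕ → ℂ} (hc : (Function.support c).Finite) :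
    (Function.support (jacobiMul s c)).Finite := by
  obtain ⟨N, hN⟩ := hc.bddAbove
  have h0 : ∀ m, N < m → c m = 0 := by
    intro m hm
    by_contra h
    exact absurd (hN h) (not_le.mpr hm)
  refine (Set.finite_Iic (N + 1)).subset fun n hn => ?_
  by_contra h
  simp only [Set.mem_Iic, not_le] at h
  apply hn
  simp [jacobiMul, h0 (n - 1) (by omega), h0 n (by omega), h0 (n + 1) (by omega)]

theorem memlp_of_finite_support {c : ℕ → ℂ} (hc : (Function.support c).Finite) :
    Memℓp c 2 :=
  (memℓp_zero hc).of_exponent_ge (by simp)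

/-- The operator `(J, F)`: multiplication by the Jacobi matrix on finitely supported sequences. -/
def jacobiPre (s : ℕ → ℝ) : L2 →ₗ.[ℂ] L2 where
  domain := finiteSeq
  toFun :=
    { toFun := fun c => ⟨jacobiMul s ((c : L2) : ℕ → ℂ),
        memlp_of_finite_support (finite_support_jacobiMul s c.2)⟩
      map_add' := by
        intro x y
        ext n
        simp only [Submodule.coe_add, lp.coeFn_add, Pi.add_apply, jacobiMul]
        split_ifs <;> ring
      map_smul' := by
        intro r x
        ext n
        simp only [Submodule.coe_smul, lp.coeFn_smul, Pi.smul_apply, jacobiMul, smul_eq_mul,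
          RingHom.id_apply]
        split_ifs <;> ring }

/-- The Jacobi operator `(T, D(T))`, the closure of `(J, F)` in `ℓ²`. -/
def jacobiOp (s : ℕ → ℝ) : L2 →ₗ.[ℂ] L2 := (jacobiPre s).closure

end HamburgerMoment

end

open MeasureTheory Polynomial

noncomputable section

namespace HamburgerMoment

/-! The Wronskian W is the boundary form of `J` (Green's formula, `wronskian_eq_sum`), and `A`, `B`,
`C`, `D` at (u, v) are its limits at infinity on the solutions `p`, `q` at u against those at v.
Since W(p_v, q_v) = -1 at every index, the Plücker relation `wronskian_mul_wronskian` expresses any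
Wronskian through Wronskians with p_v and q_v.

Domain: by Hilbert space duality, a vector of the maximal domain lies in D(T) once its boundary form
against the maximal domain vanishes (`mem_domain_jacobiOp`). By Plücker it suffices to test against
p_v and q_v. For p_u + B p_v the two limits are D(u,v) = 0 and B - B = 0; for q_u - C q_v they are C
- C = 0 and A(u,v) = 0.

Sign: if D(u,v) = 0, Plücker in the limit gives D(x,u) = -B(u,v) D(x,v), that is (x-u) K(x,u) =
B(u,v) (v-x) K(x,v) with K(x,y) = ∑ p_k(x) p_k(y). On ]u,v[ the factor K(x,v) has no zero, so it is
positive like K(v,v); and K(x,u) > 0 for x near u. Hence B(u,v) > 0. Likewise A(x,u) = C(u,v) A(x,v)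
gives C(u,v) < 0.

Convergence requires p_z and q_z in ℓ² for every z. Two distinct solutions have different Stieltjes
transforms at some non-real z (`ext_of_integral_inv_sub_eq`); Bessel's inequality for both gives ℓ²
at that z, and the estimate `IsEigen.norm_le` carries this to all z, locally uniformly. -/

variable {s : ℕ → ℝ}

/-! ### Moment functional, orthonormal polynomials, three-term recurrence. -/

/-- The moment functional as a linear map. -/
def momentLin (s : ℕ → ℝ) : ℝ[X] →ₗ[ℝ] ℝ where
  toFun := momentFunctional s
  map_add' P Q := Polynomial.sum_add_index _ _ _ (by simp) (by intros; ring)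
  map_smul' r P := by
    rw [momentFunctional, Polynomial.sum_smul_index _ _ _ (by simp), momentFunctional,
      Polynomial.sum, Polynomial.sum, RingHom.id_apply, smul_eq_mul, Finset.mul_sum]
    exact Finset.sum_congr rfl fun _ _ => by ring

theorem momentFunctional_eq_momentLin (P : ℝ[X]) : momentFunctional s P = momentLin s P := rfl

theorem momentLin_X_pow (n : ℕ) : momentLin s (X ^ n) = s n := by
  change (X ^ n : ℝ[X]).sum (fun k c => c * s k) = _
  rw [X_pow_eq_monomial, Polynomial.sum_monomial_index _ _ (by simp)]
  simp

theorem momentLin_C_mul (c : ℝ) (P : ℝ[X]) : momentLin s (C c * P) = c * momentLin s P := by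
  rw [← smul_eq_C_mul, map_smul, smul_eq_mul]

theorem IsSolution.integrable_eval {μ : Measure ℝ} (h : IsSolution s μ) (P : ℝ[X]) :
    Integrable (fun x => P.eval x) μ := by
  simp_rw [eval_eq_sum, Polynomial.sum]
  exact integrable_finsetSum _ fun k _ => (h k).1.const_mul _

theorem IsSolution.momentLin_eq {μ : Measure ℝ} (h : IsSolution s μ) (P : ℝ[X]) :
    momentLin s P = ∫ x, P.eval x ∂μ := by
  simp_rw [eval_eq_sum, Polynomial.sum]
  rw [integral_finsetSum _ fun k _ => (h k).1.const_mul _]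
  change P.sum (fun k c => c * s k) = _
  refine Finset.sum_congr rfl fun k _ => ?_
  rw [integral_const_mul, (h k).2]

theorem IsMomentSequence.momentLin_sq_pos (hs : IsMomentSequence s) {P : ℝ[X]} (hP : P ≠ 0) :
    0 < momentLin s (P ^ 2) := by
  obtain ⟨μ, hμ, hsupp⟩ := hs
  rw [hμ.momentLin_eq]
  have hint := hμ.integrable_eval (P ^ 2)
  have hnn : 0 ≤ fun x => (P ^ 2).eval x := fun x => by
    simpa using sq_nonneg (P.eval x)
  refine lt_of_le_of_ne (integral_nonneg hnn) fun h0 => hsupp ?_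
  have hae := (integral_eq_zero_iff_of_nonneg hnn hint).1 h0.symm
  -- A vanishing integral puts `μ` on the roots of `P`, a finite closed set, which then contains the
  -- support.
  have hfin : {x : ℝ | P.eval x = 0}.Finite := by
    refine P.roots.toFinset.finite_toSet.subset fun x hx => ?_
    simpa [hP] using hx
  refine hfin.subset (Measure.support_subset_of_isClosed hfin.isClosed ?_)
  filter_upwards [hae] with x hx
  simpa using hx

theorem monicOP_eq (s : ℕ → ℝ) (n : ℕ) : monicOP s n = X ^ n - ∑ k ∈ Finset.range n,
    C (momentLin s (X ^ n * monicOP s k) / momentLin s (monicOP s k ^ 2)) * monicOP s k := by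
  rw [monicOP, Finset.sum_range]
  rfl

theorem degree_monicOP (s : ℕ → ℝ) (n : ℕ) :
    (monicOP s n).degree = n ∧ (monicOP s n).Monic := by
  induction n using Nat.strong_induction_on with
  | _ n ih =>
    have hlt : (∑ k ∈ Finset.range n, C (momentLin s (X ^ n * monicOP s k) /
        momentLin s (monicOP s k ^ 2)) * monicOP s k).degree < (X ^ n : ℝ[X]).degree := by
      rw [degree_X_pow]
      refine (degree_sum_le _ _).trans_lt ?_
      rw [Finset.sup_lt_iff (by exact WithBot.bot_lt_coe n)]
      intro k hk
      have hk' := Finset.mem_range.1 hk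
      rw [← smul_eq_C_mul]
      refine (degree_smul_le _ _).trans_lt ?_
      rw [(ih k hk').1]
      exact_mod_cast hk'
    rw [monicOP_eq]
    exact ⟨by rw [degree_sub_eq_left_of_degree_lt hlt, degree_X_pow],
      (monic_X_pow n).sub_of_left hlt⟩

theorem monicOP_ne_zero (s : ℕ → ℝ) (n : ℕ) : monicOP s n ≠ 0 := (degree_monicOP s n).2.ne_zero

theorem momentLin_monicOP_mul_of_lt (hs : IsMomentSequence s) (n : ℕ) :
    ∀ m < n, momentLin s (monicOP s n * monicOP s m) = 0 := by
  induction n using Nat.strong_induction_on with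
  | _ n ih =>
    intro m hm
    have key : ∀ k ∈ Finset.range n, k ≠ m → momentLin s (C (momentLin s (X ^ n * monicOP s k) /
        momentLin s (monicOP s k ^ 2)) * monicOP s k * monicOP s m) = 0 := by
      intro k hk hkm
      rw [mul_assoc, momentLin_C_mul]
      rcases lt_or_gt_of_ne hkm with h | h
      · rw [mul_comm (monicOP s k), ih m hm k h, mul_zero]
      · rw [ih k (Finset.mem_range.1 hk) m h, mul_zero]
    rw [monicOP_eq s n, sub_mul, Finset.sum_mul, map_sub, map_sum,
      Finset.sum_eq_single_of_mem m (Finset.mem_range.2 hm) key, mul_assoc, momentLin_C_mul, ← sq,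
      div_mul_cancel₀ _ (hs.momentLin_sq_pos (monicOP_ne_zero s m)).ne', sub_self]

theorem IsMomentSequence.norm_pos (hs : IsMomentSequence s) (n : ℕ) :
    0 < Real.sqrt (momentLin s (monicOP s n ^ 2)) :=
  Real.sqrt_pos.2 (hs.momentLin_sq_pos (monicOP_ne_zero s n))

theorem momentLin_orthoPoly_mul (hs : IsMomentSequence s) (m n : ℕ) :
    momentLin s (orthoPoly s m * orthoPoly s n) = if m = n then 1 else 0 := by
  have h : orthoPoly s m * orthoPoly s n = C (Real.sqrt (momentLin s (monicOP s m ^ 2)))⁻¹ *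
      (C (Real.sqrt (momentLin s (monicOP s n ^ 2)))⁻¹ * (monicOP s m * monicOP s n)) := by
    simp only [orthoPoly, momentFunctional_eq_momentLin]
    ring
  rw [h, momentLin_C_mul, momentLin_C_mul]
  split_ifs with hmn
  · subst hmn
    rw [← sq]
    have := hs.norm_pos m
    nth_rw 3 [← Real.sq_sqrt (hs.momentLin_sq_pos (monicOP_ne_zero s m)).le]
    field_simp
  · rcases lt_or_gt_of_ne hmn with h | h
    · rw [mul_comm (monicOP s m), momentLin_monicOP_mul_of_lt hs n m h]; simp
    · rw [momentLin_monicOP_mul_of_lt hs m n h]; simp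

theorem degree_orthoPoly (hs : IsMomentSequence s) (n : ℕ) : (orthoPoly s n).degree = n := by
  rw [orthoPoly, momentFunctional_eq_momentLin, degree_C_mul (inv_ne_zero (hs.norm_pos n).ne'), (degree_monicOP s n).1]

theorem orthoPoly_ne_zero (hs : IsMomentSequence s) (n : ℕ) : orthoPoly s n ≠ 0 := by
  intro h
  simpa [h] using degree_orthoPoly hs n

theorem exists_eq_sum_orthoPoly (hs : IsMomentSequence s) (n : ℕ) :
    ∀ P : ℝ[X], P.degree < n → ∃ c : ℕ → ℝ,
      P = ∑ k ∈ Finset.range n, C (c k) * orthoPoly s k := by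
  induction n with
  | zero =>
    intro P hP
    refine ⟨0, ?_⟩
    simpa [Nat.WithBot.lt_zero_iff] using hP
  | succ n ih =>
    intro P hP
    have hl : (orthoPoly s n).leadingCoeff ≠ 0 := leadingCoeff_ne_zero.2 (orthoPoly_ne_zero hs n)
    set r := P.coeff n / (orthoPoly s n).leadingCoeff with hr
    have hdeg : (P - C r * orthoPoly s n).degree < n := by
      rw [degree_lt_iff_coeff_zero]
      intro m hm
      rcases hm.eq_or_lt with rfl | hm
      · have : (orthoPoly s n).coeff n = (orthoPoly s n).leadingCoeff := by
          rw [leadingCoeff, natDegree_eq_of_degree_eq_some (degree_orthoPoly hs n)]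
        rw [coeff_sub, coeff_C_mul, this, hr, div_mul_cancel₀ _ hl, sub_self]
      · rw [coeff_sub, coeff_C_mul, coeff_eq_zero_of_degree_lt, coeff_eq_zero_of_degree_lt]
        · simp
        · rw [degree_orthoPoly hs]; exact_mod_cast hm
        · exact hP.trans_le (by exact_mod_cast hm)
    obtain ⟨c, hc⟩ := ih _ hdeg
    refine ⟨fun k => if k = n then r else c k, ?_⟩
    simp only
    rw [Finset.sum_range_succ, if_pos rfl, ← sub_eq_iff_eq_add, hc]
    refine Finset.sum_congr rfl fun k hk => ?_
    rw [if_neg (Finset.mem_range.1 hk).ne]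

theorem eq_sum_momentLin_orthoPoly (hs : IsMomentSequence s) {n : ℕ} {P : ℝ[X]}
    (hP : P.degree < n) :
    P = ∑ k ∈ Finset.range n, C (momentLin s (P * orthoPoly s k)) * orthoPoly s k := by
  obtain ⟨c, hc⟩ := exists_eq_sum_orthoPoly hs n P hP
  have : ∀ k ∈ Finset.range n, momentLin s (P * orthoPoly s k) = c k := by
    intro k hk
    rw [hc, Finset.sum_mul, map_sum]
    simp only [mul_assoc, momentLin_C_mul, momentLin_orthoPoly_mul hs]
    simp at hk ⊢
    omega
  rw [Finset.sum_congr rfl fun k hk => by rw [this k hk]]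
  exact hc

theorem momentLin_mul_orthoPoly_of_lt (hs : IsMomentSequence s) {n : ℕ} {P : ℝ[X]}
    (hP : P.degree < n) : momentLin s (P * orthoPoly s n) = 0 := by
  obtain ⟨c, hc⟩ := exists_eq_sum_orthoPoly hs n P hP
  rw [hc, Finset.sum_mul, map_sum]
  refine Finset.sum_eq_zero fun k hk => ?_
  rw [mul_assoc, momentLin_C_mul, momentLin_orthoPoly_mul hs,
    if_neg (Finset.mem_range.1 hk).ne, mul_zero]

/-- The three-term recurrence. -/
theorem X_mul_orthoPoly (hs : IsMomentSequence s) (n : ℕ) :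
    X * orthoPoly s n = (if n = 0 then 0 else C (coeffA s (n - 1)) * orthoPoly s (n - 1)) +
      C (coeffB s n) * orthoPoly s n + C (coeffA s n) * orthoPoly s (n + 1) := by
  have hdeg : (X * orthoPoly s n).degree < ((n + 2 : ℕ) : WithBot ℕ) := by
    rw [degree_mul, degree_X, degree_orthoPoly hs]
    norm_cast
    omega
  have hB : momentLin s (X * orthoPoly s n * orthoPoly s n) = coeffB s n := by
    rw [coeffB, momentFunctional_eq_momentLin]
    congr 1
    ring
  conv_lhs => rw [eq_sum_momentLin_orthoPoly hs hdeg]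
  rw [Finset.sum_range_succ, Finset.sum_range_succ, hB]
  congr 2
  rcases n with _ | n
  · simp
  · rw [Finset.sum_range_succ, Finset.sum_eq_zero, zero_add, if_neg n.succ_ne_zero]
    · congr 2
      rw [coeffA, momentFunctional_eq_momentLin]
      congr 1
      simp only [Nat.add_sub_cancel]
      ring
    -- Below index `n`, moving `X` to the other factor leaves `X * orthoPoly s k`, of degree less
    -- than `n + 1`.
    · intro k hk
      have : X * orthoPoly s (n + 1) * orthoPoly s k = X * orthoPoly s k * orthoPoly s (n + 1) := by
        ring
      rw [this, momentLin_mul_orthoPoly_of_lt hs, C_0, zero_mul]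
      rw [degree_mul, degree_X, degree_orthoPoly hs]
      have := Finset.mem_range.1 hk
      norm_cast
      omega

theorem orthoPoly_zero (hs0 : s 0 = 1) : orthoPoly s 0 = 1 := by
  have h : monicOP s 0 = 1 := by rw [monicOP_eq]; simp
  have h1 : momentLin s 1 = 1 := by simpa [hs0] using momentLin_X_pow (s := s) 0
  rw [orthoPoly, h, momentFunctional_eq_momentLin, one_pow, h1]
  simp

/-! ### Polynomials of the second kind. -/

/-- `P ↦ ∫ (P(z) - P(x)) / (z - x) dμ(x)` as a linear map. -/
def secondKindLin (s : ℕ → ℝ) (z : ℂ) : ℝ[X] →ₗ[ℝ] ℂ where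
  toFun P := P.sum fun k c => (c : ℂ) * ∑ j ∈ Finset.range k, z ^ j * (s (k - 1 - j) : ℂ)
  map_add' P Q := Polynomial.sum_add_index _ _ _ (by simp) (by intros; push_cast; ring)
  map_smul' r P := by
    rw [Polynomial.sum_smul_index _ _ _ (by simp), Polynomial.sum, Polynomial.sum,
      RingHom.id_apply, Complex.real_smul, Finset.mul_sum]
    exact Finset.sum_congr rfl fun _ _ => by push_cast; ring

theorem q_eq_secondKindLin (n : ℕ) (z : ℂ) : q s n z = secondKindLin s z (orthoPoly s n) := rfl

theorem secondKindLin_X_pow (z : ℂ) (n : ℕ) :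
    secondKindLin s z (X ^ n) = ∑ j ∈ Finset.range n, z ^ j * (s (n - 1 - j) : ℂ) := by
  change (X ^ n : ℝ[X]).sum (fun k c => (c : ℂ) * ∑ j ∈ Finset.range k,
    z ^ j * (s (k - 1 - j) : ℂ)) = _
  rw [X_pow_eq_monomial, Polynomial.sum_monomial_index _ _ (by simp)]
  simp

theorem secondKindLin_C_mul (z : ℂ) (c : ℝ) (P : ℝ[X]) :
    secondKindLin s z (C c * P) = c * secondKindLin s z P := by
  rw [← smul_eq_C_mul, map_smul, Complex.real_smul]

/-- (z P(z) - x P(x)) / (z - x) = z (P(z) - P(x)) / (z - x) + P(x). -/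
theorem secondKindLin_X_mul (z : ℂ) (P : ℝ[X]) :
    secondKindLin s z (X * P) = z * secondKindLin s z P + (momentLin s P : ℂ) := by
  induction P using Polynomial.induction_on' with
  | add P Q hP hQ =>
    rw [mul_add, map_add, hP, hQ, map_add, map_add]
    push_cast
    ring
  | monomial n c =>
    have h : X * monomial n c = C c * X ^ (n + 1) := by
      rw [← C_mul_X_pow_eq_monomial]; ring
    rw [h, ← C_mul_X_pow_eq_monomial, secondKindLin_C_mul, secondKindLin_C_mul, momentLin_C_mul,
      secondKindLin_X_pow, secondKindLin_X_pow, momentLin_X_pow, Finset.sum_range_succ']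
    have : ∑ k ∈ Finset.range n, z ^ (k + 1) * (s (n + 1 - 1 - (k + 1)) : ℂ) =
        z * ∑ k ∈ Finset.range n, z ^ k * (s (n - 1 - k) : ℂ) := by
      rw [Finset.mul_sum]
      refine Finset.sum_congr rfl fun k _ => ?_
      rw [show n + 1 - 1 - (k + 1) = n - 1 - k by omega]
      ring
    rw [this]
    push_cast
    simp
    ring

theorem jacobiMul_p (hs : IsMomentSequence s) (z : ℂ) (n : ℕ) :
    jacobiMul s (fun k => p s k z) n = z * p s n z := by
  have h := congrArg (aeval z) (X_mul_orthoPoly hs n)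
  rw [map_mul, aeval_X] at h
  rw [p, h, jacobiMul]
  split_ifs <;> simp [p]

/-- The inhomogeneity at `n = 0` is the moment of p_n, which is zero for n > 0 by orthogonality to
p_0 = 1. -/
theorem jacobiMul_q (hs : IsMomentSequence s) (hs0 : s 0 = 1) (z : ℂ) (n : ℕ) :
    jacobiMul s (fun k => q s k z) n = z * q s n z + if n = 0 then 1 else 0 := by
  have h := congrArg (secondKindLin s z) (X_mul_orthoPoly hs n)
  have h1 : momentLin s (orthoPoly s n) = if n = 0 then 1 else 0 := by
    have := momentLin_orthoPoly_mul hs n 0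
    rwa [orthoPoly_zero hs0, mul_one] at this
  rw [secondKindLin_X_mul, h1] at h
  have h2 : ((if n = 0 then 1 else 0 : ℝ) : ℂ) = if n = 0 then 1 else 0 := by split_ifs <;> simp
  rw [q_eq_secondKindLin, ← h2, h, jacobiMul]
  split_ifs <;> simp [q_eq_secondKindLin, secondKindLin_C_mul]

theorem p_zero (hs0 : s 0 = 1) (z : ℂ) : p s 0 z = 1 := by simp [p, orthoPoly_zero hs0]

theorem q_zero (hs0 : s 0 = 1) (z : ℂ) : q s 0 z = 0 := by
  have : (1 : ℝ[X]) = X ^ 0 := by simp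
  rw [q_eq_secondKindLin, orthoPoly_zero hs0, this, secondKindLin_X_pow]
  simp

/-! ### Finite measures and their Stieltjes transforms. -/

theorem ofReal_sub_ne_zero {z : ℂ} (hz : z.im ≠ 0) (x : ℝ) : (x : ℂ) - z ≠ 0 := by
  intro h
  apply hz
  simpa using congrArg Complex.im h

theorem norm_inv_ofReal_sub_le {z : ℂ} (hz : z.im ≠ 0) (x : ℝ) :
    ‖((x : ℂ) - z)⁻¹‖ ≤ |z.im|⁻¹ := by
  rw [norm_inv]
  refine inv_anti₀ (abs_pos.2 hz) ?_
  simpa using Complex.abs_im_le_norm ((x : ℂ) - z)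

theorem continuous_inv_ofReal_sub {z : ℂ} (hz : z.im ≠ 0) :
    Continuous fun x : ℝ => ((x : ℂ) - z)⁻¹ :=
  (Complex.continuous_ofReal.sub continuous_const).inv₀ (ofReal_sub_ne_zero hz)

open BoundedContinuousFunction Filter Topology

/-- The function `x ↦ 1 / (x - z)` on the real line, for non-real `z`. -/
def resolventFun (z : {z : ℂ // z.im ≠ 0}) : ℝ →ᵇ ℂ :=
  BoundedContinuousFunction.ofNormedAddCommGroup (fun x : ℝ => ((x : ℂ) - z)⁻¹)
    (continuous_inv_ofReal_sub z.2) _ (norm_inv_ofReal_sub_le z.2)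

theorem resolventFun_apply (z : {z : ℂ // z.im ≠ 0}) (x : ℝ) :
    resolventFun z x = ((x : ℂ) - z)⁻¹ := rfl

theorem resolventFun_mul_of_ne {z w : {z : ℂ // z.im ≠ 0}} (h : z ≠ w) :
    resolventFun z * resolventFun w =
      ((z : ℂ) - w)⁻¹ • (resolventFun z - resolventFun w) := by
  ext x
  have h0 : (z : ℂ) - w ≠ 0 := sub_ne_zero.2 fun h' => h (Subtype.ext h')
  have hz := ofReal_sub_ne_zero z.2 x
  have hw := ofReal_sub_ne_zero w.2 x
  simp only [BoundedContinuousFunction.coe_mul, Pi.mul_apply, BoundedContinuousFunction.coe_smul,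
    BoundedContinuousFunction.coe_sub, Pi.sub_apply, resolventFun_apply, smul_eq_mul]
  rw [inv_sub_inv hz hw]
  field_simp
  ring

/-- The closed linear span of `1` and the functions `1 / (x - z)`. -/
def resolventSpan : Submodule ℂ (ℝ →ᵇ ℂ) :=
  (Submodule.span ℂ (insert 1 (Set.range resolventFun))).topologicalClosure

theorem resolventFun_mem (z : {z : ℂ // z.im ≠ 0}) : resolventFun z ∈ resolventSpan :=
  Submodule.le_topologicalClosure _ (Submodule.subset_span (Or.inr ⟨z, rfl⟩))

theorem one_mem_resolventSpan : (1 : ℝ →ᵇ ℂ) ∈ resolventSpan :=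
  Submodule.le_topologicalClosure _ (Submodule.subset_span (Or.inl rfl))

/-- Partial fractions handle z ≠ w; the square is a uniform limit of such products, which is why the
span has to be closed. -/
theorem resolventFun_mul_resolventFun_mem (z w : {z : ℂ // z.im ≠ 0}) :
    resolventFun z * resolventFun w ∈ resolventSpan := by
  by_cases h : z = w
  · subst h
    -- A real shift keeps the imaginary part, so one bound serves all the resolvents.
    let t : ℕ → {z : ℂ // z.im ≠ 0} := fun n => ⟨z + ((1 / ((n : ℝ) + 1) : ℝ) : ℂ), by
      simpa only [Complex.add_im, Complex.ofReal_im, add_zero] using z.2⟩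
    have ht : ∀ n, (t n : ℂ) - z = ((1 / ((n : ℝ) + 1) : ℝ) : ℂ) := fun n => add_sub_cancel_left _ _
    have hne : ∀ n, z ≠ t n := by
      intro n h
      have h1 := ht n
      rw [← h, sub_self] at h1
      have : (1 / ((n : ℝ) + 1)) ≠ 0 := by positivity
      exact this (by exact_mod_cast h1.symm)
    have him : ∀ n, (t n : ℂ).im = (z : ℂ).im := fun n => by
      simp only [t, Complex.add_im, Complex.ofReal_im, add_zero]
    have hlim : Tendsto (fun n => resolventFun (t n)) atTop (𝓝 (resolventFun z)) := by
      rw [tendsto_iff_norm_sub_tendsto_zero]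
      have h0 : Tendsto (fun n : ℕ => 1 / ((n : ℝ) + 1) * (|(z : ℂ).im|⁻¹ * |(z : ℂ).im|⁻¹)) atTop
          (𝓝 0) := by
        simpa using tendsto_one_div_add_atTop_nhds_zero_nat.mul_const
          (|(z : ℂ).im|⁻¹ * |(z : ℂ).im|⁻¹)
      refine squeeze_zero (fun _ => norm_nonneg _) (fun n => ?_) h0
      rw [BoundedContinuousFunction.norm_le (by positivity)]
      intro x
      have hx : (resolventFun (t n) - resolventFun z) x =
          ((1 / ((n : ℝ) + 1) : ℝ) : ℂ) * (((x : ℂ) - t n)⁻¹ * ((x : ℂ) - z)⁻¹) := by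
        rw [← ht, BoundedContinuousFunction.coe_sub, Pi.sub_apply, resolventFun_apply,
          resolventFun_apply, inv_sub_inv (ofReal_sub_ne_zero (t n).2 x) (ofReal_sub_ne_zero z.2 x),
          ← mul_inv, ← div_eq_mul_inv]
        congr 1
        ring
      rw [hx, norm_mul, norm_mul, Complex.norm_real, Real.norm_of_nonneg (by positivity)]
      gcongr
      · rw [← him n]; exact norm_inv_ofReal_sub_le (t n).2 x
      · exact norm_inv_ofReal_sub_le z.2 x
    refine (Submodule.isClosed_topologicalClosure _).mem_of_tendsto
      (hlim.const_mul (resolventFun z)) (Eventually.of_forall fun n => ?_)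
    rw [resolventFun_mul_of_ne (hne n)]
    exact resolventSpan.smul_mem _ (resolventSpan.sub_mem (resolventFun_mem _) (resolventFun_mem _))
  · rw [resolventFun_mul_of_ne h]
    exact resolventSpan.smul_mem _ (resolventSpan.sub_mem (resolventFun_mem _) (resolventFun_mem _))

theorem resolventFun_mul_mem (z : {z : ℂ // z.im ≠ 0}) {f : ℝ →ᵇ ℂ} (hf : f ∈ resolventSpan) :
    resolventFun z * f ∈ resolventSpan := by
  have h : resolventSpan ≤ resolventSpan.comap (LinearMap.mulLeft ℂ (resolventFun z)) := by
    refine Submodule.topologicalClosure_minimal _ (Submodule.span_le.2 ?_) ?_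
    · rintro g (rfl | ⟨w, rfl⟩)
      · simpa using resolventFun_mem z
      · exact resolventFun_mul_resolventFun_mem z w
    · exact (Submodule.isClosed_topologicalClosure _).preimage
        (continuous_const_mul (resolventFun z))
  exact h hf

theorem star_resolventFun (z : {z : ℂ // z.im ≠ 0}) :
    star (resolventFun z) = resolventFun ⟨star (z : ℂ), by simpa using z.2⟩ := by
  ext x
  rw [BoundedContinuousFunction.star_apply, resolventFun_apply, resolventFun_apply]
  simp

/-- Equality of integrals is a linear, closed condition; this passes it from resolvents to the star
algebra they generate. -/
theorem adjoin_resolventFun_le {g : ℝ →ᵇ ℂ}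
    (hg : g ∈ StarAlgebra.adjoin ℂ (Set.range resolventFun)) : g ∈ resolventSpan := by
  have hstar : star (Set.range resolventFun) ⊆ Set.range resolventFun := by
    rintro f ⟨z, hz⟩
    exact ⟨_, by rw [← star_resolventFun, hz, star_star]⟩
  rw [← StarSubalgebra.mem_toSubalgebra, StarAlgebra.adjoin_toSubalgebra,
    Set.union_eq_left.2 hstar] at hg
  -- Membership alone does not pass through products in the induction; stability of the span under
  -- multiplication by `g` does.
  have key : ∀ f ∈ resolventSpan, g * f ∈ resolventSpan := by
    induction hg using Algebra.adjoin_induction with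
    | mem x hx =>
      obtain ⟨z, rfl⟩ := hx
      exact fun f hf => resolventFun_mul_mem z hf
    | algebraMap r =>
      intro f hf
      rw [← Algebra.smul_def]
      exact resolventSpan.smul_mem _ hf
    | add x y _ _ hx hy =>
      intro f hf
      rw [add_mul]
      exact resolventSpan.add_mem (hx f hf) (hy f hf)
    | mul x y _ _ hx hy =>
      intro f hf
      rw [mul_assoc]
      exact hx _ (hy f hf)
  simpa using key 1 one_mem_resolventSpan

/-- A finite measure is determined by its total mass and its Stieltjes transform. -/
theorem ext_of_integral_inv_sub_eq {μ ν : Measure ℝ} [IsFiniteMeasure μ] [IsFiniteMeasure ν]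
    (h1 : μ.real Set.univ = ν.real Set.univ)
    (h : ∀ z : ℂ, z.im ≠ 0 → ∫ x : ℝ, ((x : ℂ) - z)⁻¹ ∂μ = ∫ x : ℝ, ((x : ℂ) - z)⁻¹ ∂ν) :
    μ = ν := by
  refine ext_of_forall_mem_subalgebra_integral_eq_of_polish (𝕜 := ℂ)
    (A := StarAlgebra.adjoin ℂ (Set.range resolventFun)) ?_ fun g hg => ?_
  · intro x y hxy
    -- A single resolvent is injective on ℝ, so it separates points.
    let z : {z : ℂ // z.im ≠ 0} := ⟨Complex.I, by simp⟩
    refine ⟨_, ⟨_, ⟨resolventFun z, StarAlgebra.subset_adjoin _ _ ⟨z, rfl⟩, rfl⟩, rfl⟩, ?_⟩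
    change resolventFun z x ≠ resolventFun z y
    rw [resolventFun_apply, resolventFun_apply]
    intro h'
    have := inv_injective h'
    simp at this
    exact hxy this
  · have hcont : ∀ (ρ : Measure ℝ) [IsFiniteMeasure ρ],
        Continuous fun f : ℝ →ᵇ ℂ => ∫ x, f x ∂ρ := by
      intro ρ _
      let L : (ℝ →ᵇ ℂ) →ₗ[ℂ] ℂ :=
        { toFun := fun f => ∫ x, f x ∂ρ
          map_add' := fun f g => integral_add (f.integrable ρ) (g.integrable ρ)
          map_smul' := fun c f => integral_smul c _ }
      exact (L.mkContinuous _ (BoundedContinuousFunction.norm_integral_le_mul_norm ρ)).continuous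
    let E : Submodule ℂ (ℝ →ᵇ ℂ) :=
      { carrier := {f | ∫ x, f x ∂μ = ∫ x, f x ∂ν}
        zero_mem' := by simp
        add_mem' := by
          intro f g hf hg
          simp only [Set.mem_ofPred_eq, BoundedContinuousFunction.coe_add, Pi.add_apply] at *
          rw [integral_add (f.integrable μ) (g.integrable μ),
            integral_add (f.integrable ν) (g.integrable ν), hf, hg]
        smul_mem' := by
          intro c f hf
          simp only [Set.mem_ofPred_eq, BoundedContinuousFunction.coe_smul] at *
          rw [integral_smul, integral_smul, hf] }
    have hE : resolventSpan ≤ E := by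
      refine Submodule.topologicalClosure_minimal _ (Submodule.span_le.2 ?_)
        (isClosed_eq (hcont μ) (hcont ν))
      rintro f (rfl | ⟨z, rfl⟩)
      · change ∫ x, (1 : ℂ) ∂μ = ∫ x, (1 : ℂ) ∂ν
        simp [h1]
      · exact h z z.2
    exact hE (adjoin_resolventFun_le hg)

/-! ### Square summability at one non-real point. -/

theorem IsSolution.isFiniteMeasure {μ : Measure ℝ} (h : IsSolution s μ) : IsFiniteMeasure μ := by
  have := (h 0).1
  simp only [pow_zero] at this
  exact (integrable_const_iff_isFiniteMeasure one_ne_zero).1 this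

theorem IsSolution.measureReal_univ {μ : Measure ℝ} (h : IsSolution s μ) :
    μ.real Set.univ = s 0 := by
  simpa using (h 0).2

theorem IsSolution.integrable_eval_mul_inv {μ : Measure ℝ} (h : IsSolution s μ) {z : ℂ}
    (hz : z.im ≠ 0) (P : ℝ[X]) :
    Integrable (fun x : ℝ => ((P.eval x : ℝ) : ℂ) * ((x : ℂ) - z)⁻¹) μ :=
  (h.integrable_eval P).ofReal.mul_bdd (c := |z.im|⁻¹)
    (continuous_inv_ofReal_sub hz).aestronglyMeasurable
    (Eventually.of_forall (norm_inv_ofReal_sub_le hz))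

/-- P(x) / (x - z) = (P(z) - P(x)) / (z - x) + P(z) / (x - z). For P = p_n this computes the Fourier
coefficients of 1 / (x - z). -/
theorem IsSolution.integral_eval_mul_inv {μ : Measure ℝ} (h : IsSolution s μ) {z : ℂ}
    (hz : z.im ≠ 0) (P : ℝ[X]) :
    ∫ x : ℝ, ((P.eval x : ℝ) : ℂ) * ((x : ℂ) - z)⁻¹ ∂μ =
      secondKindLin s z P + (∫ x : ℝ, ((x : ℂ) - z)⁻¹ ∂μ) * aeval z P := by
  have hmul : ∀ (c : ℝ) (Q : ℝ[X]),
      ∫ x : ℝ, (((C c * Q).eval x : ℝ) : ℂ) * ((x : ℂ) - z)⁻¹ ∂μ =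
      c * ∫ x : ℝ, ((Q.eval x : ℝ) : ℂ) * ((x : ℂ) - z)⁻¹ ∂μ := by
    intro c Q
    rw [← integral_const_mul]
    congr 1
    ext x
    simp only [eval_mul, eval_C]
    push_cast
    ring
  induction P using Polynomial.induction_on' with
  | add P Q hP hQ =>
    simp only [eval_add, Complex.ofReal_add, add_mul]
    rw [integral_add (h.integrable_eval_mul_inv hz P) (h.integrable_eval_mul_inv hz Q), hP, hQ,
      map_add, map_add]
    ring
  | monomial n c =>
    rw [← C_mul_X_pow_eq_monomial, hmul, secondKindLin_C_mul, map_mul, aeval_C]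
    suffices H : ∫ x : ℝ, (((X ^ n : ℝ[X]).eval x : ℝ) : ℂ) * ((x : ℂ) - z)⁻¹ ∂μ =
        secondKindLin s z (X ^ n) + (∫ x : ℝ, ((x : ℂ) - z)⁻¹ ∂μ) * aeval z (X ^ n : ℝ[X]) by
      rw [H]
      simp only [Complex.coe_algebraMap]
      ring
    induction n with
    | zero =>
      rw [secondKindLin_X_pow]
      simp
    | succ n ih =>
      have hsplit : ∀ x : ℝ, (((X ^ (n + 1) : ℝ[X]).eval x : ℝ) : ℂ) * ((x : ℂ) - z)⁻¹ =
          (((X ^ n : ℝ[X]).eval x : ℝ) : ℂ) +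
            z * ((((X ^ n : ℝ[X]).eval x : ℝ) : ℂ) * ((x : ℂ) - z)⁻¹) := by
        intro x
        have := ofReal_sub_ne_zero hz x
        simp only [eval_pow, eval_X]
        push_cast
        field_simp
        ring
      simp_rw [hsplit]
      have hint : Integrable (fun x : ℝ => (((X ^ n : ℝ[X]).eval x : ℝ) : ℂ)) μ :=
        (h.integrable_eval _).ofReal
      rw [integral_add hint ((h.integrable_eval_mul_inv hz _).const_mul z), integral_const_mul, ih,
        integral_complex_ofReal,
        ← h.momentLin_eq, pow_succ' X n, secondKindLin_X_mul, map_mul, aeval_X]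
      ring

theorem IsSolution.memLp_eval {μ : Measure ℝ} (h : IsSolution s μ) (P : ℝ[X]) :
    MemLp (fun x : ℝ => ((P.eval x : ℝ) : ℂ)) 2 μ := by
  have hcont : Continuous fun x : ℝ => ((P.eval x : ℝ) : ℂ) :=
    Complex.continuous_ofReal.comp P.continuous
  rw [memLp_two_iff_integrable_sq_norm hcont.aestronglyMeasurable]
  have hint := h.integrable_eval (P ^ 2)
  simp only [eval_pow] at hint
  simpa using hint

/-- Bessel's inequality for `x ↦ 1 / (x - z)` in `L²(μ)`. -/
theorem IsSolution.memℓp_q_add_p (hs : IsMomentSequence s) {μ : Measure ℝ} (h : IsSolution s μ)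
    {z : ℂ} (hz : z.im ≠ 0) :
    Memℓp (fun n => q s n z + (∫ x : ℝ, ((x : ℂ) - z)⁻¹ ∂μ) * p s n z) 2 := by
  have := h.isFiniteMeasure
  have hg : MemLp (fun x : ℝ => ((x : ℂ) - z)⁻¹) 2 μ :=
    MemLp.of_bound (continuous_inv_ofReal_sub hz).aestronglyMeasurable _
      (Eventually.of_forall (norm_inv_ofReal_sub_le hz))
  let f : ℕ → Lp ℂ 2 μ := fun n => (h.memLp_eval (orthoPoly s n)).toLp _
  have hin : ∀ (n : ℕ) {k : ℝ → ℂ} (hk : MemLp k 2 μ), inner ℂ (f n) (hk.toLp k) =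
      ∫ x : ℝ, (((orthoPoly s n).eval x : ℝ) : ℂ) * k x ∂μ := by
    intro n k hk
    rw [L2.inner_def]
    refine integral_congr_ae ?_
    filter_upwards [(h.memLp_eval (orthoPoly s n)).coeFn_toLp, hk.coeFn_toLp] with x h1 h2
    simp only [f]
    rw [h1, h2, RCLike.inner_apply', Complex.conj_ofReal]
  have hf : Orthonormal ℂ f := by
    rw [orthonormal_iff_ite]
    intro m n
    rw [hin m (h.memLp_eval (orthoPoly s n))]
    have : ∀ x, (((orthoPoly s m).eval x : ℝ) : ℂ) * (((orthoPoly s n).eval x : ℝ) : ℂ) =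
        (((orthoPoly s m * orthoPoly s n).eval x : ℝ) : ℂ) := by simp
    simp_rw [this]
    rw [integral_complex_ofReal, ← h.momentLin_eq, momentLin_orthoPoly_mul hs]
    split_ifs <;> simp
  have hsum := hf.inner_products_summable (hg.toLp _)
  refine (memℓp_gen_iff (by simp)).2 (hsum.congr fun n => ?_)
  rw [hin n hg, h.integral_eval_mul_inv hz]
  simp [p, q_eq_secondKindLin]

theorem IsIndeterminate.exists_memℓp (hs : IsMomentSequence s) (hind : IsIndeterminate s) :
    ∃ z : ℂ, Memℓp (fun n => p s n z) 2 ∧ Memℓp (fun n => q s n z) 2 := by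
  obtain ⟨μ, ν, hμ, hν, hne⟩ := hind
  have := hμ.isFiniteMeasure
  have := hν.isFiniteMeasure
  obtain ⟨z, hz, hzne⟩ : ∃ z : ℂ, z.im ≠ 0 ∧
      ∫ x : ℝ, ((x : ℂ) - z)⁻¹ ∂μ ≠ ∫ x : ℝ, ((x : ℂ) - z)⁻¹ ∂ν := by
    by_contra! H
    exact hne (ext_of_integral_inv_sub_eq (hμ.measureReal_univ.trans hν.measureReal_univ.symm) H)
  have h1 := hμ.memℓp_q_add_p hs hz
  have h2 := hν.memℓp_q_add_p hs hz
  set w := ∫ x : ℝ, ((x : ℂ) - z)⁻¹ ∂μ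
  set w' := ∫ x : ℝ, ((x : ℂ) - z)⁻¹ ∂ν
  -- The two ℓ² sequences q + w p and q + w' p differ by (w - w') p.
  have hp : Memℓp (fun n => p s n z) 2 := by
    convert (h1.sub h2).const_smul (w - w')⁻¹ using 1
    ext n
    have := sub_ne_zero.2 hzne
    simp only [Pi.smul_apply, Pi.sub_apply, smul_eq_mul]
    field_simp
    ring
  refine ⟨z, hp, ?_⟩
  convert h1.sub (hp.const_smul w) using 1
  ext n
  simp

/-! ### Wronskians and locally uniform bounds. -/

/-- The discrete Wronskian of two sequences. -/
def wronskian (s : ℕ → ℝ) (x y : ℕ → ℂ) (n : ℕ) : ℂ :=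
  coeffA s n * (x (n + 1) * y n - x n * y (n + 1))

/-- Green's formula: the diagonal terms cancel and the off-diagonal ones telescope. -/
theorem wronskian_eq_sum (x y : ℕ → ℂ) (n : ℕ) : wronskian s x y n =
    ∑ k ∈ Finset.range (n + 1), (jacobiMul s x k * y k - x k * jacobiMul s y k) := by
  induction n with
  | zero => simp [wronskian, jacobiMul]; ring
  | succ n ih =>
    rw [Finset.sum_range_succ, ← ih]
    simp only [wronskian, jacobiMul, n.succ_ne_zero, if_false, Nat.add_sub_cancel]
    ring

/-- The Plücker relation. -/
theorem wronskian_mul_wronskian (x y f g : ℕ → ℂ) (n : ℕ) :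
    wronskian s x y n * wronskian s f g n =
      wronskian s x f n * wronskian s y g n - wronskian s x g n * wronskian s y f n := by
  simp only [wronskian]
  ring

/-- Cramer's rule, used for variation of constants. -/
theorem mul_wronskian (x f g : ℕ → ℂ) (n : ℕ) :
    x (n + 1) * wronskian s f g n =
      wronskian s x g n * f (n + 1) - wronskian s x f n * g (n + 1) := by
  simp only [wronskian]
  ring

/-- `x` solves `J x = z x + c e₀`. -/
def IsEigen (s : ℕ → ℝ) (z c : ℂ) (x : ℕ → ℂ) : Prop :=
  ∀ n, jacobiMul s x n = z * x n + if n = 0 then c else 0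

theorem isEigen_p (hs : IsMomentSequence s) (z : ℂ) : IsEigen s z 0 (fun n => p s n z) := by
  intro n
  rw [jacobiMul_p hs]
  simp

theorem isEigen_q (hs : IsMomentSequence s) (hs0 : s 0 = 1) (z : ℂ) :
    IsEigen s z 1 (fun n => q s n z) := jacobiMul_q hs hs0 z

theorem IsEigen.wronskian_eq {z c w d : ℂ} {x y : ℕ → ℂ} (hx : IsEigen s z c x)
    (hy : IsEigen s w d y) (n : ℕ) : wronskian s x y n =
      (z - w) * ∑ k ∈ Finset.range (n + 1), x k * y k + (c * y 0 - x 0 * d) := by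
  rw [wronskian_eq_sum, Finset.sum_range_succ', Finset.sum_range_succ', mul_add, Finset.mul_sum]
  simp only [hx _, hy _, Nat.succ_ne_zero, if_false, if_true]
  rw [add_assoc]
  congr 1
  · exact Finset.sum_congr rfl fun k _ => by ring
  · ring

theorem wronskian_p_q (hs : IsMomentSequence s) (hs0 : s 0 = 1) (w : ℂ) (n : ℕ) :
    wronskian s (fun n => p s n w) (fun n => q s n w) n = -1 := by
  rw [(isEigen_p hs w).wronskian_eq (isEigen_q hs hs0 w)]
  simp [p_zero hs0]

theorem IsEigen.wronskian_succ {z c w d : ℂ} {x y : ℕ → ℂ} (hx : IsEigen s z c x)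
    (hy : IsEigen s w d y) (n : ℕ) : wronskian s x y (n + 1) =
      wronskian s x y n + (z - w) * (x (n + 1) * y (n + 1)) := by
  rw [hx.wronskian_eq hy, hx.wronskian_eq hy, Finset.sum_range_succ]
  ring

/-- A discrete Gronwall estimate: the solutions at `z` are dominated by those at `w`. -/
theorem IsEigen.norm_le (hs : IsMomentSequence s) (hs0 : s 0 = 1) {z c w : ℂ} {x : ℕ → ℂ}
    (hx : IsEigen s z c x) (hx0 : ‖x 0‖ ≤ 1) (hc : ‖c‖ ≤ 1) {R : ℝ} (hR : ‖z - w‖ ≤ R)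
    (hg : Summable fun n => (‖p s n w‖ + ‖q s n w‖) ^ 2) (n : ℕ) :
    ‖x n‖ ≤ (R + 2) * Real.exp (R * ∑' n, (‖p s n w‖ + ‖q s n w‖) ^ 2) *
      (‖p s n w‖ + ‖q s n w‖) := by
  have hR0 : 0 ≤ R := (norm_nonneg _).trans hR
  set g : ℕ → ℝ := fun n => ‖p s n w‖ + ‖q s n w‖ with hgdef
  have hg0 : ∀ n, 0 ≤ g n := fun n => by positivity
  -- `α` and `β` are the varying coefficients of `x` in terms of q_w and -p_w; they would be
  -- constant from index 0 on if z = w.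
  set α := wronskian s x (fun n => p s n w)
  set β := wronskian s x (fun n => q s n w)
  have hp := isEigen_p hs w
  have hq := isEigen_q hs hs0 w
  have hrep : ∀ n, ‖x (n + 1)‖ ≤ (‖α n‖ + ‖β n‖) * g (n + 1) := by
    intro n
    have h1 : x (n + 1) = α n * q s (n + 1) w - β n * p s (n + 1) w := by
      have h := mul_wronskian (s := s) x (fun n => p s n w) (fun n => q s n w) n
      rw [wronskian_p_q hs hs0] at h
      linear_combination -h
    rw [h1]
    refine (norm_sub_le _ _).trans ?_
    rw [norm_mul, norm_mul, add_mul]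
    gcongr
    · exact le_add_of_nonneg_left (norm_nonneg _)
    · exact le_add_of_nonneg_right (norm_nonneg _)
  have hS0 : ‖α 0‖ + ‖β 0‖ ≤ R + 2 := by
    have h1 : α 0 = (z - w) * x 0 + c := by
      simp only [α, hx.wronskian_eq hp, p_zero hs0]; simp [p_zero hs0]
    have h2 : β 0 = -x 0 := by
      simp only [β, hx.wronskian_eq hq, q_zero hs0]; simp [q_zero hs0]
    rw [h1, h2, norm_neg]
    have h3 : ‖(z - w) * x 0 + c‖ ≤ R * 1 + 1 := by
      refine (norm_add_le _ _).trans ?_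
      rw [norm_mul]
      gcongr
    linarith
  -- `hrep` bounds `x (n + 1)` by the coefficients at `n`, so each step multiplies the sum by at
  -- most 1 + R g(n+1)² ≤ exp(R g(n+1)²).
  have hS : ∀ n, ‖α n‖ + ‖β n‖ ≤ (R + 2) * Real.exp (R * ∑ k ∈ Finset.range (n + 1), g k ^ 2) := by
    intro n
    induction n with
    | zero =>
      refine hS0.trans (le_mul_of_one_le_right (by positivity) (Real.one_le_exp ?_))
      positivity
    | succ n ih =>
      have hα : ‖α (n + 1)‖ ≤ ‖α n‖ + R * (‖x (n + 1)‖ * ‖p s (n + 1) w‖) := by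
        simp only [α]
        rw [hx.wronskian_succ hp]
        refine (norm_add_le _ _).trans ?_
        rw [norm_mul, norm_mul]
        gcongr
      have hβ : ‖β (n + 1)‖ ≤ ‖β n‖ + R * (‖x (n + 1)‖ * ‖q s (n + 1) w‖) := by
        simp only [β]
        rw [hx.wronskian_succ hq]
        refine (norm_add_le _ _).trans ?_
        rw [norm_mul, norm_mul]
        gcongr
      have h1 : ‖x (n + 1)‖ * g (n + 1) ≤ (‖α n‖ + ‖β n‖) * g (n + 1) * g (n + 1) :=
        mul_le_mul_of_nonneg_right (hrep n) (hg0 _)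
      have h2 : R * (‖x (n + 1)‖ * g (n + 1)) ≤ R * ((‖α n‖ + ‖β n‖) * g (n + 1) * g (n + 1)) :=
        mul_le_mul_of_nonneg_left h1 hR0
      have h3 : ‖α (n + 1)‖ + ‖β (n + 1)‖ ≤ (‖α n‖ + ‖β n‖) * (R * g (n + 1) ^ 2 + 1) := by
        have h4 : R * (‖x (n + 1)‖ * g (n + 1)) = R * (‖x (n + 1)‖ * ‖p s (n + 1) w‖) +
            R * (‖x (n + 1)‖ * ‖q s (n + 1) w‖) := by simp only [hgdef]; ring
        nlinarith
      refine h3.trans ?_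
      rw [Finset.sum_range_succ _ (n + 1), mul_add R, Real.exp_add, ← mul_assoc]
      gcongr
      exact Real.add_one_le_exp _
  rcases n with _ | n
  -- `hrep` misses index 0; there p_0 = 1 makes the right side at least 1.
  · have h1 : (1 : ℝ) ≤ (R + 2) * Real.exp (R * ∑' n, g n ^ 2) := by
      have : (1 : ℝ) ≤ Real.exp (R * ∑' n, g n ^ 2) :=
        Real.one_le_exp (mul_nonneg hR0 (tsum_nonneg fun n => sq_nonneg _))
      nlinarith
    have h2 : (1 : ℝ) ≤ ‖p s 0 w‖ + ‖q s 0 w‖ := by simp [p_zero hs0]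
    exact hx0.trans (one_le_mul_of_one_le_of_one_le h1 h2)
  · refine (hrep n).trans (mul_le_mul_of_nonneg_right ((hS n).trans ?_) (hg0 _))
    gcongr
    exact hg.sum_le_tsum _ fun k _ => sq_nonneg _

theorem memℓp_two_iff {x : ℕ → ℂ} : Memℓp x 2 ↔ Summable fun n => ‖x n‖ ^ 2 := by
  rw [memℓp_gen_iff (by simp)]
  simp

theorem summable_mul {x y : ℕ → ℂ} (hx : Memℓp x 2) (hy : Memℓp y 2) :
    Summable fun n => x n * y n := by
  refine Summable.of_norm_bounded ((memℓp_two_iff.1 hx).add (memℓp_two_iff.1 hy)) fun n => ?_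
  rw [norm_mul]
  nlinarith [sq_nonneg (‖x n‖ - ‖y n‖), norm_nonneg (x n), norm_nonneg (y n)]

/-- In the indeterminate case the sequences `p_n(z)` and `q_n(z)` are dominated, locally uniformly
in `z`, by one square summable sequence. -/
theorem IsIndeterminate.exists_bound (hs : IsMomentSequence s) (hs0 : s 0 = 1)
    (hind : IsIndeterminate s) : ∃ g : ℕ → ℝ, Summable (fun n => g n ^ 2) ∧
      ∀ R : ℝ, ∃ M : ℝ, ∀ z : ℂ, ‖z‖ ≤ R → ∀ n, ‖p s n z‖ ≤ M * g n ∧ ‖q s n z‖ ≤ M * g n := by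
  obtain ⟨w, hp, hq⟩ := hind.exists_memℓp hs
  have hg : Summable fun n => (‖p s n w‖ + ‖q s n w‖) ^ 2 := by
    refine Summable.of_nonneg_of_le (fun n => sq_nonneg _) (fun n => ?_)
      (((memℓp_two_iff.1 hp).mul_left 2).add ((memℓp_two_iff.1 hq).mul_left 2))
    nlinarith [sq_nonneg (‖p s n w‖ - ‖q s n w‖)]
  refine ⟨_, hg, fun R => ⟨(R + ‖w‖ + 2) * Real.exp ((R + ‖w‖) *
    ∑' n, (‖p s n w‖ + ‖q s n w‖) ^ 2), fun z hz n => ?_⟩⟩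
  have hzw : ‖z - w‖ ≤ R + ‖w‖ := (norm_sub_le _ _).trans (by gcongr)
  exact ⟨(isEigen_p hs z).norm_le hs hs0 (by simp [p_zero hs0]) (by simp) hzw hg n,
    (isEigen_q hs hs0 z).norm_le hs hs0 (by simp [q_zero hs0]) (by simp) hzw hg n⟩

theorem IsIndeterminate.memℓp_p (hs : IsMomentSequence s) (hs0 : s 0 = 1)
    (hind : IsIndeterminate s) (z : ℂ) : Memℓp (fun n => p s n z) 2 := by
  obtain ⟨g, hg, hb⟩ := hind.exists_bound hs hs0
  obtain ⟨M, hM⟩ := hb ‖z‖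
  refine memℓp_two_iff.2 (Summable.of_nonneg_of_le (fun n => sq_nonneg _) (fun n => ?_)
    (hg.mul_left (M ^ 2)))
  rw [← mul_pow]
  exact pow_le_pow_left₀ (norm_nonneg _) (hM z le_rfl n).1 2

theorem IsIndeterminate.memℓp_q (hs : IsMomentSequence s) (hs0 : s 0 = 1)
    (hind : IsIndeterminate s) (z : ℂ) : Memℓp (fun n => q s n z) 2 := by
  obtain ⟨g, hg, hb⟩ := hind.exists_bound hs hs0
  obtain ⟨M, hM⟩ := hb ‖z‖
  refine memℓp_two_iff.2 (Summable.of_nonneg_of_le (fun n => sq_nonneg _) (fun n => ?_)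
    (hg.mul_left (M ^ 2)))
  rw [← mul_pow]
  exact pow_le_pow_left₀ (norm_nonneg _) (hM z le_rfl n).2 2

/-! ### Boundary form and domain of the Jacobi operator. -/

theorem tendsto_wronskian {x y : ℕ → ℂ} (hx : Memℓp x 2) (hJx : Memℓp (jacobiMul s x) 2)
    (hy : Memℓp y 2) (hJy : Memℓp (jacobiMul s y) 2) :
    Tendsto (wronskian s x y) atTop
      (𝓝 (∑' k, (jacobiMul s x k * y k - x k * jacobiMul s y k))) := by
  have h := ((summable_mul hJx hy).sub (summable_mul hx hJy)).hasSum.tendsto_sum_nat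
  rw [← tendsto_add_atTop_iff_nat 1] at h
  exact h.congr fun n => (wronskian_eq_sum x y n).symm

theorem IsEigen.tendsto_wronskian {z c w d : ℂ} {x y : ℕ → ℂ} (hx : IsEigen s z c x)
    (hy : IsEigen s w d y) (hx2 : Memℓp x 2) (hy2 : Memℓp y 2) :
    Tendsto (wronskian s x y) atTop
      (𝓝 ((z - w) * ∑' k, x k * y k + (c * y 0 - x 0 * d))) := by
  have h := (summable_mul hx2 hy2).hasSum.tendsto_sum_nat
  rw [← tendsto_add_atTop_iff_nat 1] at h
  exact ((h.const_mul (z - w)).add_const _).congr fun n => (hx.wronskian_eq hy n).symm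

theorem IsEigen.memℓp_jacobiMul {z c : ℂ} {x : ℕ → ℂ} (hx : IsEigen s z c x) (hx2 : Memℓp x 2) :
    Memℓp (jacobiMul s x) 2 := by
  have h : Memℓp (fun n : ℕ => if n = 0 then c else 0) 2 := by
    refine memlp_of_finite_support ((Set.finite_singleton 0).subset fun n hn => ?_)
    by_contra h
    exact hn (if_neg h)
  have : jacobiMul s x = z • x + fun n : ℕ => if n = 0 then c else 0 := by
    ext n
    simpa using hx n
  rw [this]
  exact (hx2.const_smul z).add h

theorem jacobiMul_star (b : ℕ → ℂ) (n : ℕ) :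
    jacobiMul s (fun k => star (b k)) n = star (jacobiMul s b n) := by
  simp only [jacobiMul]
  split_ifs <;> simp

/-- Each coordinate of `J x` involves at most three coordinates of `x`, so y = J x is a closed
condition on ℓ² × ℓ² and survives in the closure of the graph. -/
theorem isClosable_jacobiPre (s : ℕ → ℝ) : (jacobiPre s).IsClosable := by
  have heval : ∀ n : ℕ, Continuous fun x : L2 => (x : ℕ → ℂ) n := fun n =>
    (lp.evalCLM ℂ (fun _ : ℕ => ℂ) 2 n).continuous
  have hclosed : IsClosed {x : L2 × L2 | ∀ n, (x.2 : ℕ → ℂ) n = jacobiMul s x.1 n} := by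
    simp only [Set.ofPred_forall]
    refine isClosed_iInter fun n => isClosed_eq ((heval n).comp continuous_snd) ?_
    have h1 : ∀ k, Continuous fun x : L2 × L2 => (x.1 : ℕ → ℂ) k := fun k =>
      (heval k).comp continuous_fst
    unfold jacobiMul
    have h2 := h1 (n - 1)
    have h3 := h1 n
    have h4 := h1 (n + 1)
    split_ifs <;> fun_prop
  have hsub : ((jacobiPre s).graph.topologicalClosure : Set (L2 × L2)) ⊆
      {x : L2 × L2 | ∀ n, (x.2 : ℕ → ℂ) n = jacobiMul s x.1 n} := by
    rw [Submodule.topologicalClosure_coe]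
    refine closure_minimal ?_ hclosed
    intro x hx n
    obtain ⟨y, hy1, hy2⟩ := (LinearPMap.mem_graph_iff _).1 hx
    rw [← hy1, ← hy2]
    rfl
  refine ⟨Submodule.toLinearPMap _, (Submodule.toLinearPMap_graph_eq _ fun x hx hx0 => ?_).symm⟩
  ext n
  rw [hsub hx n, hx0]
  simp [jacobiMul]

/-- The `n`-th unit vector of `ℓ²`. -/
def unitSeq (n : ℕ) : L2 := lp.single (E := fun _ : ℕ => ℂ) 2 n (1 : ℂ)

theorem unitSeq_mem_finiteSeq (n : ℕ) : unitSeq n ∈ finiteSeq := by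
  refine (Set.finite_singleton n).subset fun k hk => ?_
  by_contra h
  exact hk (lp.single_apply_ne _ _ _ h)

theorem inner_jacobiPre_unitSeq (b : L2) (n : ℕ) :
    inner ℂ (jacobiPre s ⟨unitSeq n, unitSeq_mem_finiteSeq n⟩) b = jacobiMul s b n := by
  set e : ℕ → ℂ := (unitSeq n : ℕ → ℂ) with he
  have hek : ∀ k, e k = if k = n then 1 else 0 := by
    intro k
    rw [he, unitSeq]
    by_cases h : k = n
    · subst h
      simp
    · rw [lp.single_apply_ne _ _ _ h, if_neg h]
  have hstar : ∀ k, star (jacobiMul s e k) = jacobiMul s e k := by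
    intro k
    rw [← jacobiMul_star]
    congr 1
    ext j
    rw [hek]
    split_ifs <;> simp
  have hzero : ∀ k ∉ Finset.range (n + 1 + 1), jacobiMul s e k = 0 := by
    intro k hk
    have hk' : n + 1 + 1 ≤ k := by simpa using hk
    simp only [jacobiMul, hek]
    rw [if_neg (by omega : ¬ k = 0), if_neg (by omega), if_neg (by omega), if_neg (by omega)]
    simp
  have h1 : inner ℂ (jacobiPre s ⟨unitSeq n, unitSeq_mem_finiteSeq n⟩) b =
      ∑' k, jacobiMul s e k * b k := by
    rw [lp.inner_eq_tsum]
    refine tsum_congr fun k => ?_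
    rw [RCLike.inner_apply']
    exact congrArg (· * b k) (hstar k)
  -- Symmetry of `J` is Green's formula at an index past the support of `e`, where the Wronskian
  -- vanishes.
  have h2 := wronskian_eq_sum (s := s) e b (n + 1)
  have h3 : wronskian s e b (n + 1) = 0 := by
    rw [wronskian, hek, hek, if_neg (by omega), if_neg (by omega)]
    simp
  rw [h1, tsum_eq_sum fun k hk => by rw [hzero k hk, zero_mul]]
  rw [h3, Finset.sum_sub_distrib, eq_comm, sub_eq_zero] at h2
  rw [h2]
  simp [hek]

/-- A vector of the maximal domain belongs to the domain of the Jacobi operator if its boundary form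
against the maximal domain vanishes. -/
theorem mem_domain_jacobiOp {x : ℕ → ℂ} (hx : Memℓp x 2) (hJx : Memℓp (jacobiMul s x) 2)
    (hW : ∀ b : ℕ → ℂ, Memℓp b 2 → Memℓp (jacobiMul s b) 2 →
      Tendsto (wronskian s x b) atTop (𝓝 0)) :
    (⟨x, hx⟩ : L2) ∈ (jacobiOp s).domain := by
  refine LinearPMap.mem_domain_of_mem_graph (y := (⟨jacobiMul s x, hJx⟩ : L2)) ?_
  rw [jacobiOp, ← (isClosable_jacobiPre s).graph_closure_eq_closure_graph]
  -- The ℓ² product norm makes ℓ² × ℓ² a Hilbert space, where the closure of the graph is its double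
  -- orthogonal.
  let e := WithLp.prodContinuousLinearEquiv 2 ℂ L2 L2
  let K : Submodule ℂ (WithLp 2 (L2 × L2)) := (jacobiPre s).graph.comap e.toLinearEquiv.toLinearMap
  have key : WithLp.toLp 2 ((⟨x, hx⟩, ⟨jacobiMul s x, hJx⟩) : L2 × L2) ∈ K.topologicalClosure := by
    rw [← Submodule.orthogonal_orthogonal_eq_closure, Submodule.mem_orthogonal]
    intro f hf
    rw [Submodule.mem_orthogonal] at hf
    set a := (WithLp.ofLp f).1 with ha
    set b := (WithLp.ofLp f).2 with hb
    -- Orthogonality to the graph over the unit vectors places `b` in the maximal domain.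
    have hab : ∀ n, a n = -jacobiMul s b n := by
      intro n
      have h := hf (WithLp.toLp 2 (unitSeq n,
        jacobiPre s ⟨unitSeq n, unitSeq_mem_finiteSeq n⟩))
        ((LinearPMap.mem_graph_iff _).2 ⟨⟨unitSeq n, unitSeq_mem_finiteSeq n⟩, rfl, rfl⟩)
      rw [WithLp.prod_inner_apply] at h
      simp only [← ha, ← hb] at h
      rw [inner_jacobiPre_unitSeq, unitSeq, lp.inner_single_left] at h
      simpa [eq_neg_iff_add_eq_zero] using h
    have hJb : Memℓp (jacobiMul s b) 2 := by
      have : jacobiMul s b = -(a : ℕ → ℂ) := by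
        ext n
        simp [hab n]
      rw [this]
      exact (lp.memℓp a).neg
    have hstar : ∀ {c : ℕ → ℂ}, Memℓp c 2 → Memℓp (fun n => star (c n)) 2 := fun hc => by
      rw [memℓp_two_iff] at hc ⊢
      simpa using hc
    have hb2 := hstar (lp.memℓp b)
    have hJb2 : Memℓp (jacobiMul s fun n => star ((b : ℕ → ℂ) n)) 2 := by
      have : (jacobiMul s fun n => star ((b : ℕ → ℂ) n)) = fun n => star (jacobiMul s b n) :=
        funext fun n => jacobiMul_star b n
      rw [this]
      exact hstar hJb
    -- The Wronskian is bilinear and the inner product sesquilinear, hence the conjugate of `b`.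
    have hlim := tendsto_nhds_unique (tendsto_wronskian hx hJx hb2 hJb2) (hW _ hb2 hJb2)
    rw [WithLp.prod_inner_apply]
    simp only [← ha, ← hb]
    have hs1 := lp.hasSum_inner (𝕜 := ℂ) a ⟨x, hx⟩
    have hs2 := lp.hasSum_inner (𝕜 := ℂ) b ⟨jacobiMul s x, hJx⟩
    rw [← (hs1.add hs2).tsum_eq, ← hlim]
    refine tsum_congr fun k => ?_
    rw [RCLike.inner_apply', RCLike.inner_apply', hab, jacobiMul_star]
    simp only [map_neg, starRingEnd_apply]
    ring
  have := map_mem_closure e.continuous key (t := ((jacobiPre s).graph : Set (L2 × L2)))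
    fun y hy => hy
  exact this

/-- By Plücker, W(x,b) = W(x,q_v) W(b,p_v) - W(x,p_v) W(b,q_v), and the factors containing `b`
converge. -/
theorem exists_mem_domain_jacobiOp (hs : IsMomentSequence s) (hs0 : s 0 = 1)
    (hind : IsIndeterminate s) (v : ℂ) {x : ℕ → ℂ} (hx : Memℓp x 2)
    (hJx : Memℓp (jacobiMul s x) 2)
    (hWp : Tendsto (wronskian s x fun n => p s n v) atTop (𝓝 0))
    (hWq : Tendsto (wronskian s x fun n => q s n v) atTop (𝓝 0)) :
    ∃ c : L2, c ∈ (jacobiOp s).domain ∧ ∀ n, c n = x n := by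
  refine ⟨⟨x, hx⟩, mem_domain_jacobiOp hx hJx fun b hb hJb => ?_, fun n => rfl⟩
  have hp := hind.memℓp_p hs hs0 v
  have hq := hind.memℓp_q hs hs0 v
  have hbp := tendsto_wronskian hb hJb hp ((isEigen_p hs v).memℓp_jacobiMul hp)
  have hbq := tendsto_wronskian hb hJb hq ((isEigen_q hs hs0 v).memℓp_jacobiMul hq)
  have h := (hWq.mul hbp).sub (hWp.mul hbq)
  simp only [zero_mul, sub_zero] at h
  refine h.congr fun n => ?_
  have h1 := wronskian_mul_wronskian (s := s) x b (fun n => p s n v) (fun n => q s n v) n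
  rw [wronskian_p_q hs hs0] at h1
  linear_combination h1

/-! ### Sign argument. -/

/-- `G` keeps the sign of G(v) on ]u,v[. As F(x)(x - u) vanishes at u, the identity is read just to
the right of u, where F is still positive. -/
theorem pos_of_mul_sub_eq {F G : ℝ → ℝ} {u v β : ℝ} (huv : u < v)
    (hF : ContinuousOn F (Set.Icc u v)) (hG : ContinuousOn G (Set.Icc u v)) (hFu : 0 < F u)
    (hGv : 0 < G v) (hne : ∀ x ∈ Set.Ioo u v, G x ≠ 0)
    (h : ∀ x ∈ Set.Ioo u v, F x * (x - u) = β * (G x * (v - x))) : 0 < β := by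
  have hGpos : ∀ x ∈ Set.Ioo u v, 0 < G x := by
    intro x hx
    by_contra! hneg
    obtain ⟨y, hy, hy0⟩ := intermediate_value_Icc hx.2.le
      (hG.mono (Set.Icc_subset_Icc_left hx.1.le)) (show (0 : ℝ) ∈ Set.Icc (G x) (G v) from
        ⟨hneg, hGv.le⟩)
    rcases hy.2.eq_or_lt with rfl | hlt
    · exact hGv.ne' hy0
    · exact hne y ⟨hx.1.trans_le hy.1, hlt⟩ hy0
  have hev : ∀ᶠ x in 𝓝[Set.Icc u v] u, 0 < F x :=
    (hF u (Set.left_mem_Icc.2 huv.le)).eventually (lt_mem_nhds hFu)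
  have hev' : ∀ᶠ x in 𝓝[>] u, 0 < F x :=
    (nhdsWithin_Ioo_eq_nhdsGT huv) ▸ hev.filter_mono (nhdsWithin_mono _ Set.Ioo_subset_Icc_self)
  have hIoo : ∀ᶠ x in 𝓝[>] u, x ∈ Set.Ioo u v := Ioo_mem_nhdsGT huv
  obtain ⟨x, hx, hxF⟩ := (hIoo.and hev').exists
  have h1 : 0 < F x * (x - u) := mul_pos hxF (sub_pos.2 hx.1)
  rw [h x hx] at h1
  exact pos_of_mul_pos_left h1 (mul_pos (hGpos x hx) (sub_pos.2 hx.2)).le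

/-- Sign of the factor relating `K(·, u)` and `K(·, v)`, for the reproducing kernel
`K(x, y) = ∑ f_n(x) f_n(y)` and neighbouring zeros `u < v` of `x ↦ (x - v) K(x, v)`. -/
theorem pos_of_kernel_eq {f : ℕ → ℂ → ℂ} (hreal : ∀ n (x : ℝ), (f n x).im = 0)
    (hcont : ∀ n, Continuous (f n)) {g : ℕ → ℝ} (hg : Summable fun n => g n ^ 2)
    (hb : ∀ R : ℝ, ∃ M : ℝ, ∀ z : ℂ, ‖z‖ ≤ R → ∀ n, ‖f n z‖ ≤ M * g n)
    (hne : ∀ x : ℝ, ∃ n, f n x ≠ 0) {u v β : ℝ} (huv : u < v)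
    (hZ : ∀ x ∈ Set.Ioo u v, ((x : ℂ) - v) * ∑' n, f n x * f n v ≠ 0)
    (h : ∀ x ∈ Set.Ioo u v, ((x : ℂ) - u) * ∑' n, f n x * f n u =
      -β * (((x : ℂ) - v) * ∑' n, f n x * f n v)) : 0 < β := by
  let k : ℝ → ℝ → ℝ := fun y x => ∑' n, (f n x).re * (f n y).re
  have hofReal : ∀ n (x : ℝ), f n x = ((f n x).re : ℂ) := fun n x =>
    Complex.ext (by simp) (by simp [hreal])
  have hk : ∀ x y : ℝ, ∑' n, f n x * f n y = (k y x : ℂ) := by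
    intro x y
    rw [Complex.ofReal_tsum]
    refine tsum_congr fun n => ?_
    rw [hofReal n x, hofReal n y]
    simp
  -- This disc contains [u, v], so the M-test gives continuity of the kernel there.
  obtain ⟨M, hM⟩ := hb (max |u| |v|)
  have hbound : ∀ x ∈ Set.Icc u v, ∀ n, |(f n x).re| ≤ M * g n := fun x hx n =>
    (Complex.abs_re_le_norm _).trans (hM x (by simpa using abs_le_max_abs_abs hx.1 hx.2) n)
  have hle : ∀ y ∈ Set.Icc u v, ∀ n, ∀ x ∈ Set.Icc u v,
      ‖(f n x).re * (f n y).re‖ ≤ M ^ 2 * g n ^ 2 := by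
    intro y hy n x hx
    rw [Real.norm_eq_abs, abs_mul]
    calc |(f n x).re| * |(f n y).re| ≤ (M * g n) * (M * g n) :=
          mul_le_mul (hbound x hx n) (hbound y hy n) (abs_nonneg _)
            ((abs_nonneg _).trans (hbound x hx n))
      _ = M ^ 2 * g n ^ 2 := by ring
  have hkc : ∀ y ∈ Set.Icc u v, ContinuousOn (k y) (Set.Icc u v) := by
    intro y hy
    refine continuousOn_tsum (fun n => ?_) (hg.mul_left (M ^ 2)) (hle y hy)
    exact ((Complex.continuous_re.comp ((hcont n).comp Complex.continuous_ofReal)).mul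
      continuous_const).continuousOn
  have hpos : ∀ y ∈ Set.Icc u v, 0 < k y y := by
    intro y hy
    obtain ⟨n, hn⟩ := hne y
    have hre : (f n y).re ≠ 0 := fun h0 => hn (by rw [hofReal, h0]; simp)
    exact (Summable.of_norm_bounded (hg.mul_left (M ^ 2)) fun n => hle y hy n y hy).tsum_pos
      (fun m => mul_self_nonneg _) n (mul_self_pos.2 hre)
  have hu := Set.left_mem_Icc.2 huv.le
  have hv := Set.right_mem_Icc.2 huv.le
  refine pos_of_mul_sub_eq huv (hkc u hu) (hkc v hv) (hpos u hu) (hpos v hv) ?_ ?_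
  · intro x hx h0
    apply hZ x hx
    rw [hk, h0]
    simp
  · intro x hx
    have := h x hx
    rw [hk, hk] at this
    have h' : (x - u) * k u x = -β * ((x - v) * k v x) := by exact_mod_cast this
    linear_combination h'

theorem continuous_p (s : ℕ → ℝ) (n : ℕ) : Continuous (p s n) := by
  unfold p
  fun_prop

theorem continuous_q (s : ℕ → ℝ) (n : ℕ) : Continuous (q s n) := by
  unfold q Polynomial.sum
  fun_prop

theorem im_p_ofReal (n : ℕ) (x : ℝ) : (p s n x).im = 0 := by
  have : p s n x = (((orthoPoly s n).eval x : ℝ) : ℂ) := by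
    rw [p, ← Complex.coe_algebraMap, aeval_algebraMap_apply, coe_aeval_eq_eval]
  rw [this, Complex.ofReal_im]

theorem im_q_ofReal (n : ℕ) (x : ℝ) : (q s n x).im = 0 := by
  have : q s n x = (((orthoPoly s n).sum fun k c =>
      c * ∑ j ∈ Finset.range k, x ^ j * s (k - 1 - j) : ℝ) : ℂ) := by
    unfold q Polynomial.sum
    push_cast
    rfl
  rw [this, Complex.ofReal_im]

theorem im_tsum_mul_eq_zero {x y : ℕ → ℂ} (hx : ∀ n, (x n).im = 0) (hy : ∀ n, (y n).im = 0) :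
    (∑' n, x n * y n).im = 0 := by
  have : ∑' n, x n * y n = ((∑' n, (x n).re * (y n).re : ℝ) : ℂ) := by
    rw [Complex.ofReal_tsum]
    refine tsum_congr fun n => Complex.ext ?_ ?_ <;> simp [hx, hy]
  rw [this, Complex.ofReal_im]

theorem im_nevB_ofReal (u v : ℝ) : (nevB s u v).im = 0 := by
  simp [nevB, im_tsum_mul_eq_zero (fun n => im_p_ofReal (s := s) n u) fun n => im_q_ofReal n v]

theorem im_nevC_ofReal (u v : ℝ) : (nevC s u v).im = 0 := by
  simp [nevC, im_tsum_mul_eq_zero (fun n => im_q_ofReal (s := s) n u) fun n => im_p_ofReal n v]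

/-- Makes the diagonal of the `q`-kernel positive, to which q_0 = 0 contributes nothing. -/
theorem q_one_ne_zero (hs : IsMomentSequence s) (hs0 : s 0 = 1) (z : ℂ) : q s 1 z ≠ 0 := by
  intro h
  have := wronskian_p_q hs hs0 z 0
  simp [wronskian, h, q_zero hs0] at this

/-! ### Nevanlinna functions as boundary values; conclusion. -/

theorem tendsto_wronskian_p_p (hs : IsMomentSequence s) (hs0 : s 0 = 1)
    (hind : IsIndeterminate s) (u v : ℂ) :
    Tendsto (wronskian s (fun n => p s n u) fun n => p s n v) atTop (𝓝 (nevD s u v)) := by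
  simpa [nevD] using (isEigen_p hs u).tendsto_wronskian (isEigen_p hs v)
    (hind.memℓp_p hs hs0 u) (hind.memℓp_p hs hs0 v)

theorem tendsto_wronskian_p_q (hs : IsMomentSequence s) (hs0 : s 0 = 1)
    (hind : IsIndeterminate s) (u v : ℂ) :
    Tendsto (wronskian s (fun n => p s n u) fun n => q s n v) atTop (𝓝 (nevB s u v)) := by
  simpa [nevB, p_zero hs0, add_comm] using (isEigen_p hs u).tendsto_wronskian (isEigen_q hs hs0 v)
    (hind.memℓp_p hs hs0 u) (hind.memℓp_q hs hs0 v)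

theorem tendsto_wronskian_q_p (hs : IsMomentSequence s) (hs0 : s 0 = 1)
    (hind : IsIndeterminate s) (u v : ℂ) :
    Tendsto (wronskian s (fun n => q s n u) fun n => p s n v) atTop (𝓝 (nevC s u v)) := by
  simpa [nevC, p_zero hs0, add_comm] using (isEigen_q hs hs0 u).tendsto_wronskian (isEigen_p hs v)
    (hind.memℓp_q hs hs0 u) (hind.memℓp_p hs hs0 v)

theorem tendsto_wronskian_q_q (hs : IsMomentSequence s) (hs0 : s 0 = 1)
    (hind : IsIndeterminate s) (u v : ℂ) :
    Tendsto (wronskian s (fun n => q s n u) fun n => q s n v) atTop (𝓝 (nevA s u v)) := by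
  simpa [nevA, q_zero hs0] using (isEigen_q hs hs0 u).tendsto_wronskian (isEigen_q hs hs0 v)
    (hind.memℓp_q hs hs0 u) (hind.memℓp_q hs hs0 v)

/-- The limit of the Plücker relation for p_x, p_u, p_v, q_v. -/
theorem nevD_eq (hs : IsMomentSequence s) (hs0 : s 0 = 1)
    (hind : IsIndeterminate s) (u v x : ℂ) :
    nevD s x u = nevB s x v * nevD s u v - nevD s x v * nevB s u v := by
  refine tendsto_nhds_unique (tendsto_wronskian_p_p hs hs0 hind x u)
    ((((tendsto_wronskian_p_q hs hs0 hind x v).mul (tendsto_wronskian_p_p hs hs0 hind u v)).sub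
      ((tendsto_wronskian_p_p hs hs0 hind x v).mul
        (tendsto_wronskian_p_q hs hs0 hind u v))).congr fun n => ?_)
  have h := wronskian_mul_wronskian (s := s) (fun n => p s n x) (fun n => p s n u)
    (fun n => p s n v) (fun n => q s n v) n
  rw [wronskian_p_q hs hs0] at h
  linear_combination h

theorem nevA_eq (hs : IsMomentSequence s) (hs0 : s 0 = 1)
    (hind : IsIndeterminate s) (u v x : ℂ) :
    nevA s x u = nevA s x v * nevC s u v - nevC s x v * nevA s u v := by
  refine tendsto_nhds_unique (tendsto_wronskian_q_q hs hs0 hind x u)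
    ((((tendsto_wronskian_q_q hs hs0 hind x v).mul (tendsto_wronskian_q_p hs hs0 hind u v)).sub
      ((tendsto_wronskian_q_p hs hs0 hind x v).mul
        (tendsto_wronskian_q_q hs hs0 hind u v))).congr fun n => ?_)
  have h := wronskian_mul_wronskian (s := s) (fun n => q s n x) (fun n => q s n u)
    (fun n => p s n v) (fun n => q s n v) n
  rw [wronskian_p_q hs hs0] at h
  linear_combination h

theorem jacobiMul_add_mul (x y : ℕ → ℂ) (c : ℂ) :
    jacobiMul s (fun n => x n + c * y n) = jacobiMul s x + c • jacobiMul s y := by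
  ext n
  simp only [jacobiMul, Pi.add_apply, Pi.smul_apply, smul_eq_mul]
  split_ifs <;> ring

theorem wronskian_add_mul (x y b : ℕ → ℂ) (c : ℂ) (n : ℕ) :
    wronskian s (fun n => x n + c * y n) b n = wronskian s x b n + c * wronskian s y b n := by
  simp only [wronskian]
  ring

theorem wronskian_self (x : ℕ → ℂ) (n : ℕ) : wronskian s x x n = 0 := by
  simp only [wronskian]
  ring

theorem wronskian_swap (x y : ℕ → ℂ) (n : ℕ) : wronskian s x y n = -wronskian s y x n := by
  simp only [wronskian]
  ring

theorem exists_mem_domain_p_add (hs : IsMomentSequence s) (hs0 : s 0 = 1)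
    (hind : IsIndeterminate s) {u v : ℂ} (huv : nevD s u v = 0) :
    ∃ c : L2, c ∈ (jacobiOp s).domain ∧ ∀ n : ℕ, c n = p s n u + nevB s u v * p s n v := by
  have hu := hind.memℓp_p hs hs0 u
  have hv := hind.memℓp_p hs hs0 v
  refine exists_mem_domain_jacobiOp hs hs0 hind v (hu.add (hv.const_smul (nevB s u v))) ?_ ?_ ?_
  · exact (jacobiMul_add_mul _ _ _) ▸ ((isEigen_p hs u).memℓp_jacobiMul hu).add
      (((isEigen_p hs v).memℓp_jacobiMul hv).const_smul _)
  · refine (huv ▸ tendsto_wronskian_p_p hs hs0 hind u v).congr fun n => ?_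
    refine Eq.trans ?_ (wronskian_add_mul _ _ _ _ n).symm
    rw [wronskian_self, mul_zero, add_zero]
  -- The coefficient `nevB s u v` is forced here: W(p_u, q_v) tends to it and W(p_v, q_v) = -1.
  · have h := (tendsto_wronskian_p_q hs hs0 hind u v).sub_const (nevB s u v)
    rw [sub_self] at h
    refine h.congr fun n => ?_
    refine Eq.trans ?_ (wronskian_add_mul _ _ _ _ n).symm
    rw [wronskian_p_q hs hs0]
    ring

theorem exists_mem_domain_q_sub (hs : IsMomentSequence s) (hs0 : s 0 = 1)
    (hind : IsIndeterminate s) {u v : ℂ} (huv : nevA s u v = 0) :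
    ∃ c : L2, c ∈ (jacobiOp s).domain ∧ ∀ n : ℕ, c n = q s n u - nevC s u v * q s n v := by
  have hu := hind.memℓp_q hs hs0 u
  have hv := hind.memℓp_q hs hs0 v
  have key : ∃ c : L2, c ∈ (jacobiOp s).domain ∧
      ∀ n : ℕ, c n = q s n u + -nevC s u v * q s n v := by
    refine exists_mem_domain_jacobiOp hs hs0 hind v
      (hu.add (hv.const_smul (-nevC s u v))) ?_ ?_ ?_
    · exact (jacobiMul_add_mul _ _ _) ▸ ((isEigen_q hs hs0 u).memℓp_jacobiMul hu).add
        (((isEigen_q hs hs0 v).memℓp_jacobiMul hv).const_smul _)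
    · have h := (tendsto_wronskian_q_p hs hs0 hind u v).sub_const (nevC s u v)
      rw [sub_self] at h
      refine h.congr fun n => ?_
      refine Eq.trans ?_ (wronskian_add_mul _ _ _ _ n).symm
      rw [wronskian_swap (fun n => q s n v), wronskian_p_q hs hs0]
      ring
    · refine (huv ▸ tendsto_wronskian_q_q hs hs0 hind u v).congr fun n => ?_
      refine Eq.trans ?_ (wronskian_add_mul _ _ _ _ n).symm
      rw [wronskian_self, mul_zero, add_zero]
  simpa only [neg_mul, ← sub_eq_add_neg] using key

theorem nevB_re_pos (hs : IsMomentSequence s) (hs0 : s 0 = 1) (hind : IsIndeterminate s)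
    {u v : ℝ} (huv : u < v) (hD : nevD s u v = 0)
    (hZ : ∀ x ∈ Set.Ioo u v, (x : ℂ) ∉ zeroSet (nevD s) v) : 0 < (nevB s u v).re := by
  obtain ⟨g, hg, hb⟩ := hind.exists_bound hs hs0
  have hB : ((nevB s u v).re : ℂ) = nevB s u v :=
    Complex.ext (by simp) (by simp [im_nevB_ofReal])
  refine pos_of_kernel_eq (f := p s) im_p_ofReal (continuous_p s) hg
    (fun R => (hb R).imp fun M hM z hz n => (hM z hz n).1)
    (fun x => ⟨0, by simp [p_zero hs0]⟩) huv hZ fun x _ => ?_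
  have h := nevD_eq hs hs0 hind u v x
  rw [hD] at h
  simp only [nevD] at h
  rw [hB, h]
  ring

theorem nevC_re_neg (hs : IsMomentSequence s) (hs0 : s 0 = 1) (hind : IsIndeterminate s)
    {u v : ℝ} (huv : u < v) (hA : nevA s u v = 0)
    (hZ : ∀ x ∈ Set.Ioo u v, (x : ℂ) ∉ zeroSet (nevA s) v) : (nevC s u v).re < 0 := by
  obtain ⟨g, hg, hb⟩ := hind.exists_bound hs hs0
  have hC : ((nevC s u v).re : ℂ) = nevC s u v :=
    Complex.ext (by simp) (by simp [im_nevC_ofReal])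
  -- Here β = -C(u,v), since A(x,u) = C(u,v) A(x,v).
  refine neg_pos.1 (pos_of_kernel_eq (f := q s) im_q_ofReal (continuous_q s) hg
    (fun R => (hb R).imp fun M hM z hz n => (hM z hz n).2)
    (fun x => ⟨1, q_one_ne_zero hs hs0 x⟩) huv hZ fun x _ => ?_)
  have h := nevA_eq hs hs0 hind u v x
  rw [hA] at h
  simp only [nevA] at h
  rw [Complex.ofReal_neg, hC, h]
  ring

end HamburgerMoment

end

theorem mainTheorem7 (s : ℕ → ℝ) (hs : HamburgerMoment.IsMomentSequence s) (hs0 : s 0 = 1)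
    (hind : HamburgerMoment.IsIndeterminate s) (v : ℝ) :
    (∀ u : ℝ, (u : ℂ) ∈ HamburgerMoment.zeroSet (HamburgerMoment.nevD s) v → u < v →
      (∀ x ∈ Set.Ioo u v, (x : ℂ) ∉ HamburgerMoment.zeroSet (HamburgerMoment.nevD s) v) →
      ((HamburgerMoment.nevB s u v).im = 0 ∧ 0 < (HamburgerMoment.nevB s u v).re) ∧
      ∃ c : HamburgerMoment.L2, c ∈ (HamburgerMoment.jacobiOp s).domain ∧
        ∀ n : ℕ, c n = HamburgerMoment.p s n u +
          HamburgerMoment.nevB s u v * HamburgerMoment.p s n v) ∧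
    (∀ u : ℝ, (u : ℂ) ∈ HamburgerMoment.zeroSet (HamburgerMoment.nevA s) v → u < v →
      (∀ x ∈ Set.Ioo u v, (x : ℂ) ∉ HamburgerMoment.zeroSet (HamburgerMoment.nevA s) v) →
      ((HamburgerMoment.nevC s u v).im = 0 ∧ (HamburgerMoment.nevC s u v).re < 0) ∧
      ∃ c : HamburgerMoment.L2, c ∈ (HamburgerMoment.jacobiOp s).domain ∧
        ∀ n : ℕ, c n = HamburgerMoment.q s n u -
          HamburgerMoment.nevC s u v * HamburgerMoment.q s n v) := by
  refine ⟨fun u hu huv hZ => ⟨⟨HamburgerMoment.im_nevB_ofReal u v,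
      HamburgerMoment.nevB_re_pos hs hs0 hind huv hu hZ⟩,
      HamburgerMoment.exists_mem_domain_p_add hs hs0 hind hu⟩,
    fun u hu huv hZ => ⟨⟨HamburgerMoment.im_nevC_ofReal u v,
      HamburgerMoment.nevC_re_neg hs hs0 hind huv hu hZ⟩,
      HamburgerMoment.exists_mem_domain_q_sub hs hs0 hind hu⟩⟩
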